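/- Let $B$ be a Boolean algebra and let $\kappa$ be a cardinal. A subset $G \subseteq B$ generates $B$ if the only Boolean subalgebra of $B$ containing $G$ is $B$ itself. An ultrafilter of $B$ is a maximal proper filter of $B$. We say that $B$ is $\kappa$-Corson if there is a generating set $G \subseteq B$ such that $|G \cap p| < \kappa$ for every ultrafilter $p$ of $B$. Theorem. Let $\kappa$ be an uncountable regular cardinal and let $B$ be a $\kappa$-Corson Boolean algebra. Then every Boolean subalgebra of $B$ is $\kappa$-Corson. -/

import Mathlib

open Cardinal

universe u

/-- An ultrafilter of a Boolean algebra: a maximal proper filter. -/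
def IsBAUltrafilter {B : Type u} [BooleanAlgebra B] (p : Order.PFilter B) : Prop :=
  Maximal (fun F : Order.PFilter B => (⊥ : B) ∉ F) p

/-- A Boolean algebra is `κ`-Corson if it has a generating set `G` (the only Boolean subalgebra
containing `G` is the whole algebra) such that `|G ∩ p| < κ` for every ultrafilter `p`. -/
def IsCorsonAlgebra (κ : Cardinal.{u}) (B : Type u) [BooleanAlgebra B] : Prop :=
  ∃ G : Set B, BooleanSubalgebra.closure G = ⊤ ∧
    ∀ p : Order.PFilter B, IsBAUltrafilter p → #(G ∩ (p : Set B) : Set B) < κ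

/-! Points of `B` are coded by their supports, the sets of members of `G` they contain, all of size
`< κ`. For a stable `S ⊆ G`, cutting supports down to `S` sends points to points
(`exists_restrict`). Dually this gives a projection onto the subalgebra generated by `S`, and
stability also makes it preserve `A` (`exists_projection`).

Induction on `#S` then gives a good generating set for `A ∩ ⟨S⟩` (`exists_generators`); `S = G` is
the theorem. If `#S < κ`, all of `A ∩ ⟨S⟩` works. Otherwise enumerate `S` in a well-order and let `P
i ⊆ Q i` be the stable hulls of the initial segments below `i`, without and with `i`; these are
smaller than `S`. Replace each generator `h` obtained for `Q i` by `h ∆ π i h`, where `π i` projects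
onto `⟨P i⟩`. Nothing is lost, since `π i h` lies in `A ∩ ⟨P i⟩` and is generated at earlier stages.
A point contains `h ∆ π i h` only if its support meets `Q i \ P i`. These differences are disjoint,
so fewer than `κ` indices matter, and regularity bounds the total. -/

namespace CorsonAlgebra

variable {B : Type u} [BooleanAlgebra B]

/-! ### Points of a Boolean algebra, as homomorphisms to `Prop` -/

theorem point_compl (x : BoundedLatticeHom B Prop) (b : B) : x bᶜ ↔ ¬ x b := by
  rw [map_compl']; rfl

theorem point_sup (x : BoundedLatticeHom B Prop) (a b : B) : x (a ⊔ b) ↔ x a ∨ x b := by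
  rw [map_sup]; rfl

theorem point_inf (x : BoundedLatticeHom B Prop) (a b : B) : x (a ⊓ b) ↔ x a ∧ x b := by
  rw [map_inf]; rfl

theorem point_bot (x : BoundedLatticeHom B Prop) : ¬ x ⊥ := by
  rw [map_bot]; exact id

theorem point_top (x : BoundedLatticeHom B Prop) : x ⊤ := by
  rw [map_top]; trivial

theorem point_mono (x : BoundedLatticeHom B Prop) {a b : B} (h : a ≤ b) (ha : x a) : x b :=
  OrderHomClass.mono x h ha

theorem point_finset_sup (x : BoundedLatticeHom B Prop) (T : Finset B) :
    x (T.sup id) ↔ ∃ g ∈ T, x g := by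
  classical
  induction T using Finset.induction_on with
  | empty => simp
  | insert g T _ ih => simp [ih]

theorem point_symmDiff (x : BoundedLatticeHom B Prop) (a b : B) :
    x (symmDiff a b) ↔ ¬ (x a ↔ x b) := by
  rw [symmDiff, sdiff_eq, sdiff_eq, point_sup, point_inf, point_inf, point_compl, point_compl]
  tauto

/-- The point attached to a prime ideal: its elements are exactly those that are sent to `False`. -/
def pointOfPrime (J : Order.Ideal B) (hJ : J.IsPrime) : BoundedLatticeHom B Prop where
  toFun b := b ∉ J
  map_sup' a b := by
    simp only [Order.Ideal.sup_mem_iff, sup_Prop_eq, eq_iff_iff]; tauto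
  map_inf' a b := by
    simp only [inf_Prop_eq, eq_iff_iff]
    refine ⟨fun h => ⟨fun ha => h (J.lower inf_le_left ha), fun hb => h (J.lower inf_le_right hb)⟩,
      fun h hab => ?_⟩
    exact (hJ.mem_or_mem hab).elim h.1 h.2
  map_top' := by
    simp only [Prop.top_eq_true, eq_iff_iff, iff_true]
    exact hJ.toIsProper.top_notMem
  map_bot' := by simp

/-- Separation by points: a set closed under meets and a set closed under joins, no element of the
first lying below an element of the second, are separated by a point. -/
theorem exists_point {D E : Set B} (hD : InfClosed D) (hD' : D.Nonempty) (hE : SupClosed E)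
    (hE' : E.Nonempty) (h : ∀ d ∈ D, ∀ e ∈ E, ¬ d ≤ e) :
    ∃ x : BoundedLatticeHom B Prop, (∀ d ∈ D, x d) ∧ ∀ e ∈ E, ¬ x e := by
  have hF : Order.IsPFilter {b : B | ∃ d ∈ D, d ≤ b} := by
    refine .of_def (hD'.imp fun d hd => ⟨d, hd, le_rfl⟩) ?_
      fun hxy ⟨d, hd, hdx⟩ => ⟨d, hd, hdx.trans hxy⟩
    rintro a ⟨d, hd, hda⟩ b ⟨e, he, heb⟩
    exact ⟨d ⊓ e, ⟨_, hD hd he, le_rfl⟩, inf_le_left.trans hda, inf_le_right.trans heb⟩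
  have hI : Order.IsIdeal {b : B | ∃ e ∈ E, b ≤ e} := by
    refine ⟨fun a b hba ⟨e, he, hae⟩ => ⟨e, he, hba.trans hae⟩,
      hE'.imp fun e he => ⟨e, he, le_rfl⟩, ?_⟩
    rintro a ⟨d, hd, hda⟩ b ⟨e, he, heb⟩
    exact ⟨d ⊔ e, ⟨_, hE hd he, le_rfl⟩, hda.trans le_sup_left, heb.trans le_sup_right⟩
  obtain ⟨J, hJ, hIJ, hFJ⟩ := DistribLattice.prime_ideal_of_disjoint_filter_ideal
    (F := hF.toPFilter) (I := hI.toIdeal) (by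
      rw [Set.disjoint_left]
      rintro b ⟨d, hd, hdb⟩ ⟨e, he, hbe⟩
      exact h d hd e he (hdb.trans hbe))
  refine ⟨pointOfPrime J hJ, fun d hd => ?_, fun e he => ?_⟩
  · exact Set.disjoint_left.1 hFJ (show d ∈ hF.toPFilter from ⟨d, hd, le_rfl⟩)
  · exact not_not.2 (hIJ ⟨e, he, le_rfl⟩)

theorem exists_point_of_ne_bot {b : B} (hb : b ≠ ⊥) : ∃ x : BoundedLatticeHom B Prop, x b := by
  obtain ⟨x, hx, -⟩ := exists_point (D := {b}) (E := {⊥}) infClosed_singleton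
    (Set.singleton_nonempty _) supClosed_singleton (Set.singleton_nonempty _) (by simpa using hb)
  exact ⟨x, hx b rfl⟩

theorem point_iff_of_mem_closure {x y : BoundedLatticeHom B Prop} {S : Set B}
    (h : ∀ g ∈ S, (x g ↔ y g)) {b : B} (hb : b ∈ BooleanSubalgebra.closure S) : x b ↔ y b := by
  induction hb using BooleanSubalgebra.closure_bot_sup_induction with
  | mem g hg => exact h g hg
  | bot => simp only [point_bot]
  | sup a _ b _ iha ihb => rw [point_sup, point_sup, iha, ihb]
  | compl a _ iha => rw [point_compl, point_compl, iha]

/-- An element outside a subalgebra is split by two points with the same trace on it. -/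
theorem exists_points_of_notMem (A : BooleanSubalgebra B) {c : B} (hc : c ∉ A) :
    ∃ x y : BoundedLatticeHom B Prop, (∀ a ∈ A, (x a ↔ y a)) ∧ x c ∧ ¬ y c := by
  -- `z` avoids every element of `A` below `c` or below `cᶜ`, so its trace on `A` is compatible with
  -- both. Such a `z` exists because `⊤ = u ⊔ v` would force `c = u ∈ A`.
  obtain ⟨z, -, hz⟩ := exists_point (D := {⊤})
    (E := {b : B | ∃ u ∈ A, ∃ v ∈ A, u ≤ c ∧ v ≤ cᶜ ∧ b = u ⊔ v}) infClosed_singleton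
    (Set.singleton_nonempty _)
    (by
      rintro _ ⟨u, hu, v, hv, huc, hvc, rfl⟩ _ ⟨u', hu', v', hv', huc', hvc', rfl⟩
      exact ⟨u ⊔ u', A.supClosed hu hu', v ⊔ v', A.supClosed hv hv', sup_le huc huc',
        sup_le hvc hvc', sup_sup_sup_comm _ _ _ _⟩)
    ⟨⊥, ⊥, BooleanSubalgebra.bot_mem, ⊥, BooleanSubalgebra.bot_mem, by simp⟩
    (by
      rintro _ rfl _ ⟨u, hu, v, hv, huc, hvc, rfl⟩ h
      have hcu : c ≤ u := by
        have hdis : Disjoint c v := (le_compl_iff_disjoint_left.1 hvc)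
        exact hdis.left_le_of_le_sup_right (le_top.trans h)
      exact hc (le_antisymm hcu huc ▸ hu))
  have ext : ∀ d : B, (∀ a ∈ A, a ≤ dᶜ → ¬ z a) →
      ∃ x : BoundedLatticeHom B Prop, (∀ a ∈ A, (x a ↔ z a)) ∧ x d := by
    intro d hd
    obtain ⟨x, hx, -⟩ := exists_point (D := {b : B | ∃ a ∈ A, z a ∧ b = a ⊓ d}) (E := {⊥})
      (by
        rintro _ ⟨a, ha, hza, rfl⟩ _ ⟨b, hb, hzb, rfl⟩
        exact ⟨a ⊓ b, A.infClosed ha hb, (point_inf z a b).2 ⟨hza, hzb⟩, by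
          rw [inf_inf_inf_comm, inf_idem]⟩)
      ⟨_, ⊤, BooleanSubalgebra.top_mem, point_top z, rfl⟩ supClosed_singleton
      (Set.singleton_nonempty _)
      (by
        rintro _ ⟨a, ha, hza, rfl⟩ _ rfl h
        exact hd a ha (le_compl_iff_disjoint_right.2 (disjoint_iff_inf_le.2 h)) hza)
    have key : ∀ a ∈ A, z a → x a := fun a ha hza =>
      point_mono x inf_le_left (hx _ ⟨a, ha, hza, rfl⟩)
    refine ⟨x, fun a ha => ⟨fun hxa => ?_, key a ha⟩, ?_⟩
    · by_contra hza
      exact (point_compl x a).1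
        (key _ (BooleanSubalgebra.compl_mem ha) ((point_compl z a).2 hza)) hxa
    · exact point_mono x inf_le_right
        (hx _ ⟨⊤, BooleanSubalgebra.top_mem, point_top z, rfl⟩)
  obtain ⟨x, hx, hxc⟩ := ext c fun a ha hac =>
    hz a ⟨⊥, BooleanSubalgebra.bot_mem, a, ha, bot_le, hac, by simp⟩
  obtain ⟨y, hy, hyc⟩ := ext cᶜ fun a ha hac =>
    hz a ⟨a, ha, ⊥, BooleanSubalgebra.bot_mem, by simpa using hac, bot_le, by simp⟩
  exact ⟨x, y, fun a ha => (hx a ha).trans (hy a ha).symm, hxc, (point_compl y c).1 hyc⟩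

theorem isBAUltrafilter_of_point (x : BoundedLatticeHom B Prop) :
    ∃ p : Order.PFilter B, IsBAUltrafilter p ∧ ∀ b, b ∈ p ↔ x b := by
  have hF : Order.IsPFilter {b : B | x b} := by
    refine .of_def ⟨⊤, point_top x⟩ ?_ fun hab ha => point_mono x hab ha
    intro a ha b hb
    exact ⟨a ⊓ b, (point_inf x a b).2 ⟨ha, hb⟩, inf_le_left, inf_le_right⟩
  refine ⟨hF.toPFilter, ⟨point_bot x, fun F hF' hle b hb => ?_⟩, fun b => Iff.rfl⟩
  by_contra hxb
  have hc : bᶜ ∈ F := hle ((point_compl x b).2 hxb)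
  apply hF'
  rw [← inf_compl_self b]
  exact Order.PFilter.inf_mem hb hc

theorem exists_point_of_proper_pfilter (A : BooleanSubalgebra B) (p : Order.PFilter A)
    (hp : ⊥ ∉ p) : ∃ x : BoundedLatticeHom B Prop, ∀ a ∈ p, x (a : B) := by
  obtain ⟨x, hx, -⟩ := exists_point (D := (↑) '' (p : Set A)) (E := {(⊥ : B)})
    (by
      rintro _ ⟨a, ha, rfl⟩ _ ⟨b, hb, rfl⟩
      exact ⟨a ⊓ b, Order.PFilter.inf_mem ha hb, rfl⟩)
    (p.nonempty.image _) supClosed_singleton (Set.singleton_nonempty _)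
    (by
      rintro _ ⟨a, ha, rfl⟩ _ rfl h
      have : a = ⊥ := Subtype.ext (le_bot_iff.1 h)
      exact hp (this ▸ ha))
  exact ⟨x, fun a ha => hx _ ⟨a, ha, rfl⟩⟩

/-! ### Cardinality of generated subalgebras -/

theorem mk_iUnion_nat_lt {α : Type u} {μ : Cardinal.{u}} (hμ : μ.IsRegular) (hμ' : ℵ₀ < μ)
    {t : ℕ → Set α} (h : ∀ n, #(t n) < μ) : #(⋃ n, t n) < μ := by
  have := (card_iUnion_lt_iff_forall_of_isRegular (ι := ULift.{u} ℕ) (t := fun n => t n.down) hμ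
    (by simpa using hμ')).2 fun n => h n.down
  rwa [← Equiv.ulift.{u}.surjective.iUnion_comp t]

/-- A subset of size `< μ` lies in a subalgebra of size `< μ` closed under a given operation with
values of size `< μ`. -/
theorem exists_subalgebra_lt {μ : Cardinal.{u}} (hμ : μ.IsRegular) (hμ' : ℵ₀ < μ)
    (E : B → Set B) (hE : ∀ m, #(E m) < μ) {T : Set B} (hT : #T < μ) :
    ∃ W : BooleanSubalgebra B, T ⊆ W ∧ (∀ m ∈ W, E m ⊆ W) ∧ #W < μ := by
  let step : Set B → Set B := fun U =>
    U ∪ Set.image2 (· ⊔ ·) U U ∪ compl '' U ∪ ⋃ m ∈ U, E m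
  let W : ℕ → Set B := fun n => step^[n] (T ∪ {⊥})
  have hsucc : ∀ n, W (n + 1) = step (W n) := fun n => Function.iterate_succ_apply' _ _ _
  have hmono : Monotone W := monotone_nat_of_le_succ fun n => by
    rw [hsucc]
    exact fun b hb => Or.inl (Or.inl (Or.inl hb))
  have hcard : ∀ n, #(W n) < μ := by
    intro n
    induction n with
    | zero =>
      exact (mk_union_le _ _).trans_lt (add_lt_of_lt hμ.aleph0_le hT
        (by simpa using one_lt_aleph0.trans hμ'))
    | succ n ih =>
      rw [hsucc]
      refine (mk_union_le _ _).trans_lt (add_lt_of_lt hμ.aleph0_le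
        ((mk_union_le _ _).trans_lt (add_lt_of_lt hμ.aleph0_le
          ((mk_union_le _ _).trans_lt (add_lt_of_lt hμ.aleph0_le ih ?_)) ?_)) ?_)
      · exact mk_image2_le.trans_lt (mul_lt_of_lt hμ.aleph0_le ih ih)
      · exact mk_image_le.trans_lt ih
      · exact (card_biUnion_lt_iff_forall_of_isRegular hμ ih).2 fun m _ => hE m
  have hsup : ∀ a ∈ ⋃ n, W n, ∀ b ∈ ⋃ n, W n, a ⊔ b ∈ ⋃ n, W n := by
    intro a ha b hb
    obtain ⟨n, hn⟩ := Set.mem_iUnion.1 ha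
    obtain ⟨k, hk⟩ := Set.mem_iUnion.1 hb
    refine Set.mem_iUnion.2 ⟨max n k + 1, ?_⟩
    rw [hsucc]
    exact Or.inl (Or.inl (Or.inr
      ⟨a, hmono (le_max_left _ _) hn, b, hmono (le_max_right _ _) hk, rfl⟩))
  have hcompl : ∀ a ∈ ⋃ n, W n, aᶜ ∈ ⋃ n, W n := by
    intro a ha
    obtain ⟨n, hn⟩ := Set.mem_iUnion.1 ha
    refine Set.mem_iUnion.2 ⟨n + 1, ?_⟩
    rw [hsucc]
    exact Or.inl (Or.inr ⟨a, hn, rfl⟩)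
  refine ⟨{ carrier := ⋃ n, W n
            supClosed' := fun a ha b hb => hsup a ha b hb
            infClosed' := fun a ha b hb => ?_
            compl_mem' := fun ha => hcompl _ ha
            bot_mem' := Set.mem_iUnion.2 ⟨0, Or.inr rfl⟩ },
    fun t ht => Set.mem_iUnion.2 ⟨0, Or.inl ht⟩, fun m hm e he => ?_,
    mk_iUnion_nat_lt hμ hμ' hcard⟩
  · have := hcompl _ (hsup _ (hcompl _ ha) _ (hcompl _ hb))
    rwa [compl_sup, compl_compl, compl_compl] at this
  · obtain ⟨n, hn⟩ := Set.mem_iUnion.1 (show m ∈ ⋃ n, W n from hm)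
    refine Set.mem_iUnion.2 ⟨n + 1, ?_⟩
    rw [hsucc]
    exact Or.inr (Set.mem_biUnion hn he)

theorem mk_closure_lt {μ : Cardinal.{u}} (hμ : μ.IsRegular) (hμ' : ℵ₀ < μ) {T : Set B}
    (hT : #T < μ) : #(BooleanSubalgebra.closure T) < μ := by
  obtain ⟨W, hTW, -, hW⟩ := exists_subalgebra_lt hμ hμ' (fun _ => ∅)
    (fun _ => by simpa using hμ.pos) hT
  exact (mk_le_mk_of_subset (BooleanSubalgebra.closure_le.2 hTW)).trans_lt hW

/-- The subalgebra generated by a directed union is the union of the generated subalgebras. -/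
theorem exists_mem_closure_of_directed {ι : Type*} [Nonempty ι] {S : ι → Set B}
    (hS : Directed (· ⊆ ·) S) {b : B} (hb : b ∈ BooleanSubalgebra.closure (⋃ i, S i)) :
    ∃ i, b ∈ BooleanSubalgebra.closure (S i) := by
  induction hb using BooleanSubalgebra.closure_bot_sup_induction with
  | mem g hg =>
    obtain ⟨i, hi⟩ := Set.mem_iUnion.1 hg
    exact ⟨i, BooleanSubalgebra.subset_closure hi⟩
  | bot => exact ⟨Classical.arbitrary ι, BooleanSubalgebra.bot_mem⟩
  | sup a _ b _ iha ihb =>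
    obtain ⟨i, hi⟩ := iha
    obtain ⟨j, hj⟩ := ihb
    obtain ⟨k, hik, hjk⟩ := hS i j
    exact ⟨k, BooleanSubalgebra.sup_mem (BooleanSubalgebra.closure_mono hik hi)
      (BooleanSubalgebra.closure_mono hjk hj)⟩
  | compl a _ iha => exact iha.imp fun _ => BooleanSubalgebra.compl_mem

/-! ### Witness operations -/

/-- If every point contains fewer than `κ` elements of `G`, then the finite covers of a nonzero
element by members of `G` have a transversal of size less than `κ`. -/
theorem exists_transversal {κ : Cardinal.{u}} (hκ : κ.IsRegular) {G : Set B}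
    (hG : ∀ x : BoundedLatticeHom B Prop, #{g ∈ G | x g} < κ) {m : B} (hm : m ≠ ⊥) :
    ∃ E ⊆ G, #E < κ ∧ ∀ T : Finset B, ↑T ⊆ G → m ≤ T.sup id → ∃ g ∈ T, g ∈ E := by
  classical
  obtain ⟨x, hx⟩ := exists_point_of_ne_bot hm
  have hmeet : ∀ T : Finset B, m ≤ T.sup id → ∃ g ∈ T, x g := fun T hT =>
    (point_finset_sup x T).1 (point_mono x hT hx)
  -- A maximal disjoint family of finite covers has size `< κ`, since each cover uses up its own
  -- generator true at `x`. By maximality its union meets every cover.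
  obtain ⟨P, hP⟩ := zorn_subset
    {P : Set (Finset B) | (∀ T ∈ P, ↑T ⊆ G ∧ m ≤ T.sup id) ∧ P.Pairwise Disjoint} (by
      intro c hc hchain
      refine ⟨⋃₀ c, ⟨?_, ?_⟩, fun s hs => Set.subset_sUnion_of_mem hs⟩
      · rintro T ⟨s, hs, hT⟩
        exact (hc hs).1 T hT
      · exact (Set.pairwise_sUnion hchain.directedOn).2 fun s hs => (hc hs).2)
  have hPcard : #P < κ := by
    choose! f hfT hfx using fun T (hT : T ∈ P) => hmeet T (hP.prop.1 T hT).2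
    refine lt_of_le_of_lt ?_ (hG x)
    refine mk_le_of_injective (f := fun T : P => ⟨f T, (hP.prop.1 T T.2).1 (hfT T T.2), hfx T T.2⟩)
      fun T T' h => ?_
    by_contra hne
    have h' : f T = f T' := congrArg Subtype.val h
    exact Finset.disjoint_left.1 (hP.prop.2 T.2 T'.2 fun h => hne (Subtype.ext h))
      (hfT T T.2) (h' ▸ hfT T' T'.2)
  refine ⟨⋃ T ∈ P, (T : Set B), ?_, ?_, ?_⟩
  · exact Set.iUnion₂_subset fun T hT => (hP.prop.1 T hT).1
  · exact (card_biUnion_lt_iff_forall_of_isRegular hκ hPcard).2 fun T _ =>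
      (lt_aleph0_iff_set_finite.2 T.finite_toSet).trans_le hκ.aleph0_le
  · intro T hTG hT
    by_contra hcon
    push Not at hcon
    have hdisj : ∀ T' ∈ P, Disjoint T T' := fun T' hT' => Finset.disjoint_left.2 fun g hg hg' =>
      hcon g hg (Set.mem_biUnion hT' hg')
    have hins : insert T P ⊆ P := hP.le_of_ge
      ⟨by
        rintro T' (rfl | hT')
        exacts [⟨hTG, hT⟩, hP.prop.1 T' hT'],
       hP.prop.2.insert fun T' hT' _ => ⟨hdisj T' hT', (hdisj T' hT').symm⟩⟩
      (Set.subset_insert T P)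
    obtain ⟨g, hg, -⟩ := hmeet T hT
    exact Finset.disjoint_left.1 (hdisj T (hins (Set.mem_insert T P))) hg hg

/-- An operation `E` that assigns to each element `m` a small set of generators which meets all
finite covers of `m` by generators and, if `m` is not in `A`, contains the supports of two points
that split `m` and agree on `A`. -/
structure IsWitness (κ : Cardinal.{u}) (G : Set B) (A : BooleanSubalgebra B) (E : B → Set B) :
    Prop where
  subset : ∀ m, E m ⊆ G
  card_lt : ∀ m, #(E m) < κ
  transversal : ∀ m, m ≠ ⊥ → ∀ T : Finset B, ↑T ⊆ G → m ≤ T.sup id → ∃ g ∈ T, g ∈ E m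
  split : ∀ c ∉ A, ∃ x y : BoundedLatticeHom B Prop, (∀ a ∈ A, (x a ↔ y a)) ∧ x c ∧ ¬ y c ∧
    (∀ g ∈ G, x g → g ∈ E c) ∧ ∀ g ∈ G, y g → g ∈ E c

theorem exists_isWitness {κ : Cardinal.{u}} (hκ : κ.IsRegular) {G : Set B}
    (hG : ∀ x : BoundedLatticeHom B Prop, #{g ∈ G | x g} < κ) (A : BooleanSubalgebra B) :
    ∃ E, IsWitness κ G A E := by
  have h₁ : ∀ m : B, ∃ E ⊆ G, #E < κ ∧
      (m ≠ ⊥ → ∀ T : Finset B, ↑T ⊆ G → m ≤ T.sup id → ∃ g ∈ T, g ∈ E) := by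
    intro m
    by_cases hm : m = ⊥
    · exact ⟨∅, Set.empty_subset _, by simpa using hκ.pos, fun h => (h hm).elim⟩
    · obtain ⟨E, hEG, hE, hT⟩ := exists_transversal hκ hG hm
      exact ⟨E, hEG, hE, fun _ => hT⟩
  have h₂ : ∀ c : B, ∃ E ⊆ G, #E < κ ∧
      (c ∉ A → ∃ x y : BoundedLatticeHom B Prop, (∀ a ∈ A, (x a ↔ y a)) ∧ x c ∧ ¬ y c ∧
        (∀ g ∈ G, x g → g ∈ E) ∧ ∀ g ∈ G, y g → g ∈ E) := by
    intro c
    by_cases hc : c ∈ A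
    · exact ⟨∅, Set.empty_subset _, by simpa using hκ.pos, fun h => (h hc).elim⟩
    · obtain ⟨x, y, hxy, hxc, hyc⟩ := exists_points_of_notMem A hc
      refine ⟨{g ∈ G | x g} ∪ {g ∈ G | y g},
        Set.union_subset (Set.sep_subset _ _) (Set.sep_subset _ _),
        (mk_union_le _ _).trans_lt (add_lt_of_lt hκ.aleph0_le (hG x) (hG y)), fun _ => ?_⟩
      exact ⟨x, y, hxy, hxc, hyc, fun g hg h => Or.inl ⟨hg, h⟩, fun g hg h => Or.inr ⟨hg, h⟩⟩
  choose E₁ hE₁G hE₁ hT using h₁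
  choose E₂ hE₂G hE₂ hS using h₂
  refine ⟨fun m => E₁ m ∪ E₂ m, fun m => Set.union_subset (hE₁G m) (hE₂G m),
    fun m => (mk_union_le _ _).trans_lt (add_lt_of_lt hκ.aleph0_le (hE₁ m) (hE₂ m)),
    fun m hm T hTG hmT => ?_, fun c hc => ?_⟩
  · obtain ⟨g, hg, hgE⟩ := hT m hm T hTG hmT
    exact ⟨g, hg, Or.inl hgE⟩
  · obtain ⟨x, y, hxy, hxc, hyc, hx, hy⟩ := hS c hc
    exact ⟨x, y, hxy, hxc, hyc, fun g hg h => Or.inr (hx g hg h), fun g hg h => Or.inr (hy g hg h)⟩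

/-! ### Stable sets of generators -/

/-- `S` contains `E m` for each `m` in the subalgebra generated by `S`. -/
def IsStable (E : B → Set B) (S : Set B) : Prop :=
  ∀ m ∈ BooleanSubalgebra.closure S, E m ⊆ S

/-- The least stable set containing `T`. -/
def stableHull (E : B → Set B) (T : Set B) : Set B :=
  ⋂₀ {S | T ⊆ S ∧ IsStable E S}

theorem subset_stableHull (E : B → Set B) (T : Set B) : T ⊆ stableHull E T :=
  Set.subset_sInter fun _ hS => hS.1

theorem stableHull_subset {E : B → Set B} {S T : Set B} (hTS : T ⊆ S) (hS : IsStable E S) :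
    stableHull E T ⊆ S :=
  Set.sInter_subset_of_mem ⟨hTS, hS⟩

theorem isStable_stableHull (E : B → Set B) (T : Set B) : IsStable E (stableHull E T) :=
  fun m hm => Set.subset_sInter fun _ hS =>
    hS.2 m (BooleanSubalgebra.closure_mono (Set.sInter_subset_of_mem hS) hm)

theorem stableHull_mono (E : B → Set B) {T T' : Set B} (h : T ⊆ T') :
    stableHull E T ⊆ stableHull E T' :=
  stableHull_subset (h.trans (subset_stableHull E T')) (isStable_stableHull E T')

theorem isStable_iUnion {E : B → Set B} {ι : Type*} [Nonempty ι] {S : ι → Set B}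
    (hS : Directed (· ⊆ ·) S) (h : ∀ i, IsStable E (S i)) : IsStable E (⋃ i, S i) := by
  intro m hm
  obtain ⟨i, hi⟩ := exists_mem_closure_of_directed hS hm
  exact (h i m hi).trans (Set.subset_iUnion S i)

theorem mk_stableHull_lt_of_isRegular {μ : Cardinal.{u}} (hμ : μ.IsRegular) (hμ' : ℵ₀ < μ)
    {E : B → Set B} (hE : ∀ m, #(E m) < μ) {T : Set B} (hT : #T < μ) :
    #(stableHull E T) < μ := by
  obtain ⟨W, hTW, hEW, hW⟩ := exists_subalgebra_lt hμ hμ' E hE hT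
  refine (mk_le_mk_of_subset (stableHull_subset hTW fun m hm => ?_)).trans_lt hW
  exact hEW m (BooleanSubalgebra.closure_le.2 subset_rfl hm)

/-- Here `μ` may be singular, so the regular case is applied at the successor of `#T` once `κ ≤ #T`.
-/
theorem mk_stableHull_lt {κ μ : Cardinal.{u}} (hκ : κ.IsRegular) (hκ' : ℵ₀ < κ) (hκμ : κ ≤ μ)
    {E : B → Set B} (hE : ∀ m, #(E m) < κ) {T : Set B} (hT : #T < μ) :
    #(stableHull E T) < μ := by
  rcases lt_or_ge #T κ with h | h
  · exact (mk_stableHull_lt_of_isRegular hκ hκ' hE h).trans_le hκμ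
  · have h' := mk_stableHull_lt_of_isRegular (isRegular_succ (hκ.aleph0_le.trans h))
      ((hκ'.trans_le h).trans (Order.lt_succ _)) (fun m => ((hE m).trans_le h).trans
        (Order.lt_succ _)) (Order.lt_succ #T)
    exact (Order.lt_succ_iff.1 h').trans_lt hT

/-- An infinite set has a well-ordered enumeration with proper initial segments of smaller size. -/
theorem exists_wellOrdered_enumeration {α : Type u} {S : Set α} (hS : ℵ₀ ≤ #S) :
    ∃ (ι : Type u) (_ : LinearOrder ι) (_ : WellFoundedLT ι) (e : ι → α),
      Set.range e = S ∧ ∀ i, #(e '' Set.Iic i) < #S := by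
  obtain ⟨ι, ⟨f⟩⟩ : ∃ ι : Type u, Nonempty (ι ≃ S) := ⟨S, ⟨Equiv.refl _⟩⟩
  have hι : #ι = #S := mk_congr f
  obtain ⟨_, _, hord⟩ := exists_ord_eq_type_lt ι
  refine ⟨ι, inferInstance, inferInstance, fun i => f i, ?_, fun i => mk_image_le.trans_lt ?_⟩
  · rw [show (fun i => (f i : α)) = Subtype.val ∘ f from rfl, f.surjective.range_comp,
      Subtype.range_coe]
  · rw [← Set.Iio_insert]
    exact mk_insert_le.trans_lt (add_lt_of_lt hS (hι ▸ mk_Iio_lt i hord) (one_lt_aleph0.trans_le hS))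

/-! ### Retractions onto stable sets, and the induction on cardinality -/

namespace IsWitness

variable {κ : Cardinal.{u}} {G : Set B} {A : BooleanSubalgebra B} {E : B → Set B}

/-- Truncating the support of a point to a stable set gives the support of a point. -/
theorem exists_restrict (hE : IsWitness κ G A E) {S : Set B} (hS : IsStable E S)
    (x : BoundedLatticeHom B Prop) :
    ∃ y : BoundedLatticeHom B Prop, ∀ g ∈ G, (y g ↔ g ∈ S ∧ x g) := by
  classical
  obtain ⟨y, hy, hy'⟩ := exists_point (D := {m | m ∈ BooleanSubalgebra.closure S ∧ x m})
    (E := {b : B | ∃ T : Finset B, ↑T ⊆ G \ S ∧ b = T.sup id})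
    (fun a ha b hb => ⟨BooleanSubalgebra.inf_mem ha.1 hb.1, (point_inf x a b).2 ⟨ha.2, hb.2⟩⟩)
    ⟨⊤, BooleanSubalgebra.top_mem, point_top x⟩
    (by
      rintro _ ⟨T, hT, rfl⟩ _ ⟨T', hT', rfl⟩
      exact ⟨T ∪ T', by simpa using ⟨hT, hT'⟩, Finset.sup_union.symm⟩)
    ⟨⊥, ∅, by simp⟩
    -- A cover of `m ∈ ⟨S⟩` by generators outside `S` would meet `E m ⊆ S`.
    (by
      rintro m ⟨hm, hxm⟩ _ ⟨T, hT, rfl⟩ hmT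
      obtain ⟨g, hg, hgE⟩ := hE.transversal m (fun h => point_bot x (h ▸ hxm)) T
        (hT.trans Set.sdiff_subset) hmT
      exact (hT hg).2 (hS m hm hgE))
  refine ⟨y, fun g hg => ⟨fun hyg => ?_, fun h => hy g ⟨BooleanSubalgebra.subset_closure h.1, h.2⟩⟩⟩
  have hgS : g ∈ S := by
    by_contra hgS
    exact hy' g ⟨{g}, by simpa using ⟨hg, hgS⟩, by simp⟩ hyg
  refine ⟨hgS, ?_⟩
  by_contra hxg
  exact (point_compl y g).1 (hy _ ⟨BooleanSubalgebra.compl_mem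
    (BooleanSubalgebra.subset_closure hgS), (point_compl x g).2 hxg⟩) hyg

/-- For stable `S`, restriction of points to `S` is dual to a projection onto the subalgebra
generated by `S`, and this projection maps `A` to itself. -/
theorem exists_projection (hE : IsWitness κ G A E) (hG : BooleanSubalgebra.closure G = ⊤)
    {S : Set B} (hS : IsStable E S) (b : B) :
    ∃ c ∈ BooleanSubalgebra.closure S, (b ∈ A → c ∈ A) ∧
      ∀ x y : BoundedLatticeHom B Prop, (∀ g ∈ G, (y g ↔ g ∈ S ∧ x g)) → (x c ↔ y b) := by
  have hb : b ∈ BooleanSubalgebra.closure G := hG ▸ BooleanSubalgebra.mem_top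
  have h : ∃ c ∈ BooleanSubalgebra.closure S, ∀ x y : BoundedLatticeHom B Prop,
      (∀ g ∈ G, (y g ↔ g ∈ S ∧ x g)) → (x c ↔ y b) := by
    induction hb using BooleanSubalgebra.closure_bot_sup_induction with
    | mem g hg =>
      by_cases hgS : g ∈ S
      · exact ⟨g, BooleanSubalgebra.subset_closure hgS, fun x y h => by simp [h g hg, hgS]⟩
      · exact ⟨⊥, BooleanSubalgebra.bot_mem, fun x y h => by simp [h g hg, hgS]⟩
    | bot => exact ⟨⊥, BooleanSubalgebra.bot_mem, fun x y _ => by simp only [point_bot]⟩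
    | sup a _ b _ iha ihb =>
      obtain ⟨c, hc, h⟩ := iha
      obtain ⟨d, hd, h'⟩ := ihb
      exact ⟨c ⊔ d, BooleanSubalgebra.sup_mem hc hd, fun x y hxy => by
        rw [point_sup, point_sup, h x y hxy, h' x y hxy]⟩
    | compl a _ iha =>
      obtain ⟨c, hc, h⟩ := iha
      exact ⟨cᶜ, BooleanSubalgebra.compl_mem hc, fun x y hxy => by
        rw [point_compl, point_compl, h x y hxy]⟩
  obtain ⟨c, hc, h⟩ := h
  refine ⟨c, hc, fun hbA => ?_, h⟩
  by_contra hcA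
  obtain ⟨x, y, hxy, hxc, hyc, hx, hy⟩ := hE.split c hcA
  -- The supports of `x` and `y` lie in `E c ⊆ S`, so truncation fixes both points and `c` agrees
  -- with `b ∈ A` there; but `x` and `y` agree on `A` and differ on `c`.
  have hself : ∀ z : BoundedLatticeHom B Prop, (∀ g ∈ G, z g → g ∈ E c) → (z c ↔ z b) :=
    fun z hz => h z z fun g hg => ⟨fun hzg => ⟨hS c hc (hz g hg hzg), hzg⟩, fun h => h.2⟩
  exact hyc ((hself y hy).2 ((hxy b hbA).1 ((hself x hx).1 hxc)))

/-- For stable `S`, the part of `A` in the subalgebra generated by `S` has a generating set with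
fewer than `κ` elements in each point. -/
theorem exists_generators (hE : IsWitness κ G A E) (hκ : κ.IsRegular) (hκ' : ℵ₀ < κ)
    (hG : BooleanSubalgebra.closure G = ⊤)
    (hGx : ∀ x : BoundedLatticeHom B Prop, #{g ∈ G | x g} < κ) (S : Set B) (hSG : S ⊆ G)
    (hS : IsStable E S) :
    ∃ H : Set B, H ⊆ A ∧ H ⊆ BooleanSubalgebra.closure S ∧
      (∀ a ∈ A, a ∈ BooleanSubalgebra.closure S → a ∈ BooleanSubalgebra.closure H) ∧
      ∀ x : BoundedLatticeHom B Prop, #{h ∈ H | x h} < κ := by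
  induction hl : #S using WellFoundedLT.induction generalizing S with
  | ind l ih =>
  subst hl
  rcases lt_or_ge #S κ with hlt | hge
  · refine ⟨A ∩ BooleanSubalgebra.closure S, Set.inter_subset_left, Set.inter_subset_right,
      fun a ha haS => BooleanSubalgebra.subset_closure ⟨ha, haS⟩, fun x => ?_⟩
    exact (mk_le_mk_of_subset ((Set.sep_subset _ _).trans Set.inter_subset_right)).trans_lt
      (mk_closure_lt hκ hκ' hlt)
  have ih' : ∀ T ⊆ S, #T < #S → ∃ H : Set B, H ⊆ A ∧
      H ⊆ BooleanSubalgebra.closure (stableHull E T) ∧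
      (∀ a ∈ A, a ∈ BooleanSubalgebra.closure (stableHull E T) →
        a ∈ BooleanSubalgebra.closure H) ∧
      ∀ x : BoundedLatticeHom B Prop, #{h ∈ H | x h} < κ := fun T hTS hT =>
    ih _ (mk_stableHull_lt hκ hκ' hge hE.card_lt hT) _ ((stableHull_subset hTS hS).trans hSG)
      (isStable_stableHull E T) rfl
  obtain ⟨ι, _, _, e, he, hIic⟩ := exists_wellOrdered_enumeration (hκ.aleph0_le.trans hge)
  have heS : ∀ i, e i ∈ S := fun i => he ▸ Set.mem_range_self i
  let P : ι → Set B := fun i => stableHull E (e '' Set.Iio i)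
  let Q : ι → Set B := fun i => stableHull E (e '' Set.Iic i)
  have hQmono : Monotone Q := fun i j hij =>
    stableHull_mono E (Set.image_mono (Set.Iic_subset_Iic.2 hij))
  have hQP : ∀ i j, i < j → Q i ⊆ P j := fun i j hij =>
    stableHull_mono E (Set.image_mono (Set.Iic_subset_Iio.2 hij))
  have hQS : ∀ i, Q i ⊆ S := fun i =>
    stableHull_subset (by rintro _ ⟨j, -, rfl⟩; exact heS j) hS
  -- The hull of `∅` can be nonempty, as `⟨∅⟩` contains `⊤`; `H₀` starts the recursion at the least
  -- index.
  obtain ⟨H₀, hH₀A, hH₀cl, hH₀gen, hH₀⟩ := ih' ∅ (Set.empty_subset _)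
    (by simpa using hκ.pos.trans_le hge)
  choose H hHA hHcl hHgen hH using fun i : ι => ih' (e '' Set.Iic i)
    (by rintro _ ⟨j, -, rfl⟩; exact heS j) (hIic i)
  choose π hπcl hπA hπ using fun i : ι =>
    hE.exists_projection hG (isStable_stableHull E (e '' Set.Iio i : Set B))
  let K : Set B := H₀ ∪ ⋃ i, (fun h => symmDiff h (π i h)) '' H i
  have symmDiff_mem : ∀ (L : BooleanSubalgebra B) {a b : B}, a ∈ L → b ∈ L → symmDiff a b ∈ L :=
    fun L a b ha hb => BooleanSubalgebra.sup_mem (BooleanSubalgebra.sdiff_mem ha hb)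
      (BooleanSubalgebra.sdiff_mem hb ha)
  have hgen : ∀ i, ∀ a ∈ A, a ∈ BooleanSubalgebra.closure (Q i) →
      a ∈ BooleanSubalgebra.closure K := by
    intro i
    induction i using WellFoundedLT.induction with
    | ind i ihi =>
    have hPgen : ∀ a ∈ A, a ∈ BooleanSubalgebra.closure (P i) →
        a ∈ BooleanSubalgebra.closure K := by
      intro a ha haP
      rcases (Set.Iio i).eq_empty_or_nonempty with hemp | hne
      · refine BooleanSubalgebra.closure_mono Set.subset_union_left (hH₀gen a ha ?_)
        simpa [P, hemp] using haP
      · have : Nonempty (Set.Iio i) := hne.to_subtype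
        have hdir : Directed (· ⊆ ·) fun j : Set.Iio i => Q j :=
          (hQmono.comp (Subtype.mono_coe _)).directed_le
        have hsub : P i ⊆ ⋃ j : Set.Iio i, Q j := by
          refine stableHull_subset ?_ (isStable_iUnion hdir fun j => isStable_stableHull E _)
          rintro _ ⟨j, hj, rfl⟩
          exact Set.mem_iUnion.2 ⟨⟨j, hj⟩, subset_stableHull E _ ⟨j, Set.self_mem_Iic, rfl⟩⟩
        obtain ⟨j, hj⟩ := exists_mem_closure_of_directed hdir
          (BooleanSubalgebra.closure_mono hsub haP)
        exact ihi j j.2 a ha hj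
    intro a ha haQ
    refine BooleanSubalgebra.closure_le.2 (fun h hh => ?_) (hHgen i a ha haQ)
    have h₁ : π i h ∈ BooleanSubalgebra.closure K :=
      hPgen _ (hπA i h (hHA i hh)) (hπcl i h)
    have h₂ : symmDiff h (π i h) ∈ BooleanSubalgebra.closure K :=
      BooleanSubalgebra.subset_closure (Or.inr (Set.mem_iUnion.2 ⟨i, h, hh, rfl⟩))
    have h₃ := symmDiff_mem _ h₂ h₁
    rwa [symmDiff_symmDiff_cancel_right] at h₃
  have hSne : S.Nonempty := Set.nonempty_coe_sort.1 (mk_ne_zero_iff.1 (hκ.pos.trans_le hge).ne')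
  have : Nonempty ι := Set.range_nonempty_iff_nonempty.1 (he.symm ▸ hSne)
  refine ⟨K, ?_, ?_, fun a ha haS => ?_, fun x => ?_⟩
  · refine Set.union_subset hH₀A (Set.iUnion_subset fun i => ?_)
    rintro _ ⟨h, hh, rfl⟩
    exact symmDiff_mem A (hHA i hh) (hπA i h (hHA i hh))
  · refine Set.union_subset (hH₀cl.trans (BooleanSubalgebra.closure_mono
      (stableHull_subset (Set.empty_subset _) hS))) (Set.iUnion_subset fun i => ?_)
    rintro _ ⟨h, hh, rfl⟩
    exact symmDiff_mem _ (BooleanSubalgebra.closure_mono (hQS i) (hHcl i hh))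
      (BooleanSubalgebra.closure_mono (((stableHull_mono E (Set.image_mono
        Set.Iio_subset_Iic_self)).trans (hQS i))) (hπcl i h))
  · have hsub : S ⊆ ⋃ i, Q i := by
      rw [← he]
      rintro _ ⟨i, rfl⟩
      exact Set.mem_iUnion.2 ⟨i, subset_stableHull E _ ⟨i, Set.self_mem_Iic, rfl⟩⟩
    obtain ⟨i, hi⟩ := exists_mem_closure_of_directed hQmono.directed_le
      (BooleanSubalgebra.closure_mono hsub haS)
    exact hgen i a ha hi
  -- `y i` is `x` truncated to `P i`, so `x` evaluates `π i h` as `y i` evaluates `h`.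
  · choose y hy using fun i : ι =>
      hE.exists_restrict (isStable_stableHull E (e '' Set.Iio i)) x
    let I : Set ι := {i | ∃ g ∈ Q i, g ∉ P i ∧ x g}
    have hI : #I < κ := by
      choose! f hfQ hfP hfx using fun i (hi : i ∈ I) => hi
      refine lt_of_le_of_lt ?_ (hGx x)
      refine mk_le_of_injective
        (f := fun i : I => ⟨f i, hSG (hQS i (hfQ i i.2)), hfx i i.2⟩) fun i j hij => ?_
      have hij' : f i = f j := congrArg Subtype.val hij
      rcases lt_trichotomy (i : ι) j with h | h | h
      · exact (hfP j j.2 (hij' ▸ hQP i j h (hfQ i i.2))).elim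
      · exact Subtype.ext h
      · exact (hfP i i.2 (hij' ▸ hQP j i h (hfQ j j.2))).elim
    have hsub : {k ∈ K | x k} ⊆ {h ∈ H₀ | x h} ∪ ⋃ i ∈ I,
        (fun h => symmDiff h (π i h)) '' ({h ∈ H i | x h} ∪ {h ∈ H i | y i h}) := by
      rintro k ⟨hk | hk, hxk⟩
      · exact Or.inl ⟨hk, hxk⟩
      obtain ⟨i, h, hh, rfl⟩ := Set.mem_iUnion.1 hk
      have hne : ¬ (x h ↔ y i h) := by
        rwa [point_symmDiff, hπ i h x (y i) (hy i)] at hxk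
      refine Or.inr (Set.mem_biUnion (x := i) ?_ ⟨h, ?_, rfl⟩)
      -- If `x` has no generator in `Q i \ P i`, then `x` and `y i` agree on `Q i`, hence at `h`.
      · by_contra hi
        refine hne (point_iff_of_mem_closure (fun g hg => ?_) (hHcl i hh))
        rw [hy i g (hSG (hQS i hg))]
        refine ⟨fun hxg => ⟨?_, hxg⟩, fun h => h.2⟩
        by_contra hgP
        exact hi ⟨g, hg, hgP, hxg⟩
      · by_cases hxh : x h
        · exact Or.inl ⟨hh, hxh⟩
        · exact Or.inr ⟨hh, by tauto⟩
    refine (mk_le_mk_of_subset hsub).trans_lt ((mk_union_le _ _).trans_lt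
      (add_lt_of_lt hκ.aleph0_le (hH₀ x) ?_))
    exact (card_biUnion_lt_iff_forall_of_isRegular hκ hI).2 fun i _ => mk_image_le.trans_lt
      ((mk_union_le _ _).trans_lt (add_lt_of_lt hκ.aleph0_le (hH i x) (hH i (y i))))

end IsWitness

end CorsonAlgebra

theorem mainTheorem3 (κ : Cardinal.{u}) (hκ : κ.IsRegular) (hκ' : ℵ₀ < κ)
    (B : Type u) [BooleanAlgebra B] (hB : IsCorsonAlgebra κ B) (A : BooleanSubalgebra B) :
    IsCorsonAlgebra κ A := by
  obtain ⟨G, hG, hGp⟩ := hB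
  have hGx : ∀ x : BoundedLatticeHom B Prop, #{g ∈ G | x g} < κ := by
    intro x
    obtain ⟨p, hp, hpx⟩ := CorsonAlgebra.isBAUltrafilter_of_point x
    refine lt_of_le_of_lt (mk_le_mk_of_subset fun g hg => ?_) (hGp p hp)
    exact ⟨hg.1, (hpx g).2 hg.2⟩
  obtain ⟨E, hE⟩ := CorsonAlgebra.exists_isWitness hκ hGx A
  obtain ⟨H, hHA, -, hHgen, hH⟩ := hE.exists_generators hκ hκ' hG hGx G subset_rfl
    fun m _ => hE.subset m
  refine ⟨(↑) ⁻¹' H, ?_, fun p hp => ?_⟩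
  · refine eq_top_iff.2 fun a _ => ?_
    have hle : BooleanSubalgebra.closure H ≤
        (BooleanSubalgebra.closure ((↑) ⁻¹' H : Set A)).map A.subtype :=
      BooleanSubalgebra.closure_le.2 fun h hh =>
        ⟨⟨h, hHA hh⟩, BooleanSubalgebra.subset_closure hh, rfl⟩
    obtain ⟨b, hb, hba⟩ := hle (hHgen a a.2 (hG ▸ BooleanSubalgebra.mem_top))
    exact (Subtype.ext hba : b = a) ▸ hb
  -- Only properness of `p` matters: it extends to a point of `B`, whose trace on `H` bounds that of
  -- `p`.
  · obtain ⟨x, hx⟩ := CorsonAlgebra.exists_point_of_proper_pfilter A p hp.prop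
    refine lt_of_le_of_lt ?_ (hH x)
    exact mk_le_of_injective (f := fun a : (Subtype.val ⁻¹' H ∩ (p : Set A) : Set A) =>
      ⟨(a : A), a.2.1, hx a a.2.2⟩) fun a b hab =>
        Subtype.ext (Subtype.ext (Subtype.mk.inj hab))
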